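/- Model. There are $n$ asynchronous deterministic processes, modeled as (possibly infinite) state machines. Each process $i$ has one shared register $R_i$, which only process $i$ can write and all processes can read; reads and writes are atomic, and the initial contents of the registers are fixed by the algorithm. A register of $b$ bits has $2^b$ possible contents; a register of unbounded size can hold any finite binary word. Each process has a private input and may irrevocably decide one output value; it may go on accessing the memory after deciding. In an execution, steps of the processes are interleaved arbitrarily, and a process that at some point stops taking steps without having halted has crashed. A task consists of a finite set $\mathcal I$ of input configurations, a finite set $\mathcal O$ of (possibly partial) output configurations closed under taking faces, and, for each $\sigma\in\mathcal I$, a set $\Delta(\sigma)\subseteq\mathcal O$, closed under taking faces, of legal output configurations. An algorithm solves the task in the $t$-resilient model if, for every $\sigma\in\mathcal I$, in every execution on inputs $\sigma$ in which at most $t$ processes crash, every process that does not crash decides, and the decided values form a configuration in $\Delta(\sigma)$. For an integer $k\ge 1$, (binary) $\frac1k$-agreement is the task in which each process has an arbitrary input in $\{0,1\}$, all outputs are of the form $m/k$ with $m\in\{0,\dots,k\}$, any two outputs differ by at most $\frac1k$, and if all $n$ inputs are equal to the same $x$ then every output is $x$. Theorem. Let $f:\mathbb N\to\mathbb N$, let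 $n>2$ and let $t$ be an integer with $\frac n2<t<n$. Then there is a task with binary inputs, namely $\frac1k$-agreement with $k=2\cdot\bigl(2^{f(n)}\bigr)^{n-t+1}+1$, that can be solved by $n$ processes in the $t$-resilient shared-memory model with registers of unbounded size (even by an algorithm in which every process halts as soon as it decides), but that cannot be solved by $n$ processes in the $t$-resilient shared-memory model with registers of $f(n)$ bits (even if processes may go on taking steps after deciding). -/

import Mathlib

/-! Asynchronous read/write shared memory with crash failures, tasks, and approximate agreement. -/

/-- A (possibly partial) output configuration of `n` processes: `τ i = some y` means that process
`i` has output `y`, and `τ i = none` that process `i` has no output. -/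
abbrev OutConfig (n : ℕ) (B : Type) : Type := Fin n → Option B

/-- `τ'` is a face of `τ`: every output of `τ'` is an output of `τ`. -/
def OutConfig.IsFace {n : ℕ} {B : Type} (τ' τ : OutConfig n B) : Prop :=
  ∀ (i : Fin n) (y : B), τ' i = some y → τ i = some y

/-- A task `(I, O, Δ)` for `n` processes with input values in `A` and output values in `B`: a finite
set of input configurations, a finite complex of output configurations, and the subcomplex `Δ σ` of
the output configurations that are legal for the input configuration `σ`. -/
structure DistTask (n : ℕ) (A B : Type) where
  inputs : Set (Fin n → A)
  inputs_finite : inputs.Finite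
  outputs : Set (OutConfig n B)
  outputs_finite : outputs.Finite
  outputs_face : ∀ τ ∈ outputs, ∀ τ' : OutConfig n B, τ'.IsFace τ → τ' ∈ outputs
  Δ : (Fin n → A) → Set (OutConfig n B)
  Δ_subset : ∀ σ ∈ inputs, Δ σ ⊆ outputs
  Δ_face : ∀ σ ∈ inputs, ∀ τ ∈ Δ σ, ∀ τ' : OutConfig n B, τ'.IsFace τ → τ' ∈ Δ σ

/-- What a process does next: nothing any more, or one atomic access to the shared memory, namely a
write of `v` in its own register or a read of the register of process `j`, and the new local state
(which depends on the value read). -/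
inductive Instr (n : ℕ) (V S : Type) : Type where
  | halt : Instr n V S
  | write (v : V) (next : S) : Instr n V S
  | read (j : Fin n) (next : V → S) : Instr n V S

/-- An algorithm for `n` processes, each with one single-writer multi-reader register with contents
in `V`. The processes are deterministic state machines with (possibly infinite) set of states `S`.
Once a process has an output it keeps it, but it may go on accessing the memory. -/
structure Algorithm (n : ℕ) (A B V S : Type) where
  /-- initial contents of the registers -/
  initReg : Fin n → V
  /-- initial state of a process with a given private input -/
  start : Fin n → A → S
  /-- next instruction of a process in a given state -/
  instr : Fin n → S → Instr n V S
  /-- the value that a process in a given state has decided, if any -/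
  output : Fin n → S → Option B
  output_write : ∀ (i : Fin n) (s : S) (y : B) (v : V) (s' : S), output i s = some y →
    instr i s = Instr.write v s' → output i s' = some y
  output_read : ∀ (i : Fin n) (s : S) (y : B) (j : Fin n) (g : V → S), output i s = some y →
    instr i s = Instr.read j g → ∀ v : V, output i (g v) = some y

/-- A global state: the contents of the registers and the local states of the processes. -/
structure GlobalState (n : ℕ) (V S : Type) where
  reg : Fin n → V
  loc : Fin n → S

/-- The set of processes that crash under an infinite schedule: those that are scheduled only
finitely often. (Scheduling a process that has halted has no effect, so every execution, finite or
infinite, is given by a schedule in which the halted processes that have not crashed go on being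
scheduled.) -/
def crashed {n : ℕ} (sched : ℕ → Fin n) : Set (Fin n) :=
  {i | {m : ℕ | sched m = i}.Finite}

namespace Algorithm

variable {n : ℕ} {A B V S : Type}

/-- Process `i` takes one atomic step. -/
def step (P : Algorithm n A B V S) (c : GlobalState n V S) (i : Fin n) : GlobalState n V S :=
  match P.instr i (c.loc i) with
  | Instr.halt => c
  | Instr.write v s => ⟨Function.update c.reg i v, Function.update c.loc i s⟩
  | Instr.read j g => ⟨c.reg, Function.update c.loc i (g (c.reg j))⟩

/-- The global state after `m` steps of the execution on inputs `σ` under the schedule `sched`. -/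
def run (P : Algorithm n A B V S) (σ : Fin n → A) (sched : ℕ → Fin n) : ℕ → GlobalState n V S
  | 0 => ⟨P.initReg, fun i => P.start i (σ i)⟩
  | m + 1 => P.step (P.run σ sched m) (sched m)

/-- The output values decided so far in a global state. -/
def outConfig (P : Algorithm n A B V S) (c : GlobalState n V S) : OutConfig n B :=
  fun i => P.output i (c.loc i)

/-- `P` solves the task `T` in the `t`-resilient model: in every execution on an input configuration
of `T` in which at most `t` processes crash, every process that does not crash decides, and the
decided values form a configuration that is legal for the inputs. -/
def Solves (P : Algorithm n A B V S) (T : DistTask n A B) (t : ℕ) : Prop :=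
  ∀ σ ∈ T.inputs, ∀ sched : ℕ → Fin n, (crashed sched).ncard ≤ t →
    ∃ τ ∈ T.Δ σ, (∀ i, i ∉ crashed sched → τ i ≠ none) ∧
      ∀ᶠ m in Filter.atTop, P.outConfig (P.run σ sched m) = τ

/-- Every process halts as soon as it has decided. -/
def HaltsOnDecision (P : Algorithm n A B V S) : Prop :=
  ∀ (i : Fin n) (s : S), P.output i s ≠ none → P.instr i s = Instr.halt

end Algorithm

/-- `T` is solvable in the `t`-resilient model with registers with contents in `V`. -/
def Solvable {n : ℕ} {A B : Type} (V : Type) (t : ℕ) (T : DistTask n A B) : Prop :=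
  ∃ (S : Type) (P : Algorithm n A B V S), P.Solves T t

/-- `T` is solvable in the `t`-resilient model with registers with contents in `V`, by an algorithm
whose processes halt as soon as they have decided. -/
def SolvableHalting {n : ℕ} {A B : Type} (V : Type) (t : ℕ) (T : DistTask n A B) : Prop :=
  ∃ (S : Type) (P : Algorithm n A B V S), P.Solves T t ∧ P.HaltsOnDecision

/-- A halting solution is in particular a solution. -/
theorem SolvableHalting.solvable {n : ℕ} {A B V : Type} {t : ℕ} {T : DistTask n A B}
    (h : SolvableHalting V t T) : Solvable V t T := by
  obtain ⟨S, P, hP, -⟩ := h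
  exact ⟨S, P, hP⟩

/-- Contents of a register of unbounded size: a finite word of bits of any length. -/
abbrev UnboundedReg : Type := List Bool

/-- Contents of a register of `b` bits. -/
abbrev BitReg (b : ℕ) : Type := Fin b → Bool

/-- The output configurations with all values of the form `m / k` with `0 ≤ m ≤ k`. -/
def gridConfigs (n k : ℕ) : Set (OutConfig n ℚ) :=
  {τ | ∀ (i : Fin n) (y : ℚ), τ i = some y → ∃ m : ℕ, m ≤ k ∧ y = (m : ℚ) / (k : ℚ)}

theorem gridConfigs_finite (n k : ℕ) : (gridConfigs n k).Finite := by
  have h1 : {q : ℚ | ∃ m : ℕ, m ≤ k ∧ q = (m : ℚ) / (k : ℚ)}.Finite := by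
    refine ((Set.finite_Iic k).image (fun m : ℕ => (m : ℚ) / (k : ℚ))).subset ?_
    rintro q ⟨m, hm, rfl⟩
    exact ⟨m, hm, rfl⟩
  have h2 : {o : Option ℚ | ∀ y, o = some y → ∃ m : ℕ, m ≤ k ∧ y = (m : ℚ) / (k : ℚ)}.Finite := by
    refine ((h1.image some).insert none).subset ?_
    intro o ho
    cases o with
    | none => exact Set.mem_insert _ _
    | some q => exact Set.mem_insert_of_mem _ ⟨q, ho q rfl, rfl⟩
  refine (Set.Finite.pi' (fun _ : Fin n => h2)).subset ?_
  intro τ hτ i y hy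
  exact hτ i y hy

/-- Binary `ε`-agreement for `n` processes with `ε = 1 / k`, `k ≥ 1`: the inputs are arbitrary in
`{0, 1}`; the outputs are of the form `m / k` with `0 ≤ m ≤ k`; if all processes start with the same
value, only this value may be output; any two outputs are at distance at most `1 / k`. -/
def approxAgreement (n k : ℕ) : DistTask n (Fin 2) ℚ where
  inputs := Set.univ
  inputs_finite := Set.finite_univ
  outputs := gridConfigs n k
  outputs_finite := gridConfigs_finite n k
  outputs_face := fun _ hτ _ h i y hy => hτ i y (h i y hy)
  Δ := fun σ => {τ | τ ∈ gridConfigs n k ∧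
    (∀ x : Fin 2, (∀ i, σ i = x) → ∀ (i : Fin n) (y : ℚ), τ i = some y → y = ((x : ℕ) : ℚ)) ∧
    (∀ (i j : Fin n) (y z : ℚ), τ i = some y → τ j = some z → |y - z| ≤ 1 / (k : ℚ))}
  Δ_subset := fun _ _ _ hτ => hτ.1
  Δ_face := fun _ _ _ hτ _ h => ⟨fun i y hy => hτ.1 i y (h i y hy),
    fun x hx i y hy => hτ.2.1 x hx i y (h i y hy),
    fun i j y z hy hz => hτ.2.2 i j y z (h i y hy) (h j z hz)⟩

/-! Lower bound. Fix a set `Q` of `n - t + 1` processes and let the other `t - 1` take no steps, so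
that one further crash inside `Q` is still tolerated. For every threshold `m / k` the bivalence
argument of Fischer, Lynch and Paterson applies to the classes "at most `m / k`" and "above `m /
k`". Approximate agreement does not forbid both classes in one execution, so the argument yields not
a contradiction but an execution of `Q` with decisions in both classes, necessarily `m / k` and `(m
+ 1) / k` (`exists_disagreement`, `exists_adjacent_outputs`).

Apply this to `m = 2 * a` for `M + 1` values of `a`, where `M` is the number of joint contents of
the registers of `Q`. Two of these executions leave the same memory. Now all of `Q` crashes, which
is allowed because `n - t + 1 ≤ t`; the remaining processes cannot tell the two executions apart and
decide the same value in both. That value would be within `1 / k` of both `2 * a / k` and `(2 * b +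
1) / k` with `a < b`, which is impossible (`not_solvable_approxAgreement`).

Upper bound. With unbounded registers each process publishes its whole history of estimates and
repeatedly moves to the midpoint of what it sees. The first estimate published in a round is seen by
everybody, so the range of the estimates halves (`exists_halved_range`), whatever the number of
crashes. -/

/-! ### Finite executions. -/

namespace Algorithm

variable {n : ℕ} {A B V S : Type}

/-- The initial global state on inputs `σ`. -/
def initial (P : Algorithm n A B V S) (σ : Fin n → A) : GlobalState n V S :=
  ⟨P.initReg, fun i => P.start i (σ i)⟩

/-- The global state reached from `c` when the processes take steps in the order of the list. -/
def runFrom (P : Algorithm n A B V S) (c : GlobalState n V S) (l : List (Fin n)) :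
    GlobalState n V S :=
  l.foldl P.step c

@[simp] theorem runFrom_nil (P : Algorithm n A B V S) (c : GlobalState n V S) :
    P.runFrom c [] = c := rfl

@[simp] theorem runFrom_cons (P : Algorithm n A B V S) (c : GlobalState n V S) (i : Fin n)
    (l : List (Fin n)) : P.runFrom c (i :: l) = P.runFrom (P.step c i) l := rfl

theorem runFrom_append (P : Algorithm n A B V S) (c : GlobalState n V S) (l l' : List (Fin n)) :
    P.runFrom c (l ++ l') = P.runFrom (P.runFrom c l) l' := List.foldl_append

theorem run_eq_runFrom (P : Algorithm n A B V S) (σ : Fin n → A) (sched : ℕ → Fin n) (m : ℕ) :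
    P.run σ sched m = P.runFrom (P.initial σ) ((List.range m).map sched) := by
  induction m with
  | zero => rfl
  | succ m ih => rw [List.range_succ, List.map_append, runFrom_append, ← ih]; rfl

theorem step_loc_of_ne (P : Algorithm n A B V S) (c : GlobalState n V S) {i j : Fin n}
    (h : j ≠ i) : (P.step c i).loc j = c.loc j := by
  unfold step
  split <;> simp [Function.update_of_ne h]

theorem step_reg_of_ne (P : Algorithm n A B V S) (c : GlobalState n V S) {i j : Fin n}
    (h : j ≠ i) : (P.step c i).reg j = c.reg j := by
  unfold step
  split <;> simp [Function.update_of_ne h]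

theorem runFrom_loc_of_notMem (P : Algorithm n A B V S) (c : GlobalState n V S) (j : Fin n)
    (l : List (Fin n)) (h : j ∉ l) : (P.runFrom c l).loc j = c.loc j := by
  induction l generalizing c with
  | nil => rfl
  | cons i l ih =>
    rw [List.mem_cons, not_or] at h
    rw [runFrom_cons, ih _ h.2, step_loc_of_ne _ _ h.1]

theorem runFrom_reg_of_notMem (P : Algorithm n A B V S) (c : GlobalState n V S) (j : Fin n)
    (l : List (Fin n)) (h : j ∉ l) : (P.runFrom c l).reg j = c.reg j := by
  induction l generalizing c with
  | nil => rfl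
  | cons i l ih =>
    rw [List.mem_cons, not_or] at h
    rw [runFrom_cons, ih _ h.2, step_reg_of_ne _ _ h.1]

/-- A decision is irrevocable. -/
theorem output_step (P : Algorithm n A B V S) (c : GlobalState n V S) (i j : Fin n) (y : B)
    (h : P.output j (c.loc j) = some y) : P.output j ((P.step c i).loc j) = some y := by
  by_cases hij : j = i
  · subst hij
    unfold step
    split
    · next hs => exact h
    · next v s hs => simpa using P.output_write j _ y v s h hs
    · next k g hs => simpa using P.output_read j _ y k g h hs _
  · rwa [step_loc_of_ne _ _ hij]

theorem output_runFrom (P : Algorithm n A B V S) (c : GlobalState n V S) (l : List (Fin n))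
    (j : Fin n) (y : B) (h : P.output j (c.loc j) = some y) :
    P.output j ((P.runFrom c l).loc j) = some y := by
  induction l generalizing c with
  | nil => exact h
  | cons i l ih => exact ih _ (P.output_step c i j y h)

end Algorithm

/-! ### Indistinguishability and schedules. -/

/-- Two global states that the processes in `W` cannot distinguish. -/
def GlobalState.Agree {n : ℕ} {V S : Type} (W : Finset (Fin n)) (c c' : GlobalState n V S) : Prop :=
  c.reg = c'.reg ∧ ∀ i ∈ W, c.loc i = c'.loc i

/-- First the list `l`, then the sequence `g`. -/
def prependList {α : Type} (l : List α) (g : ℕ → α) : ℕ → α :=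
  fun m => if h : m < l.length then l[m] else g (m - l.length)

theorem map_range_prependList {α : Type} (l : List α) (g : ℕ → α) (m : ℕ) :
    (List.range (l.length + m)).map (prependList l g) = l ++ (List.range m).map g := by
  apply List.ext_getElem
  · simp
  · intro k h1 h2
    simp only [List.getElem_map, List.getElem_range, prependList, List.getElem_append]

theorem prependList_add {α : Type} (l : List α) (g : ℕ → α) (m : ℕ) :
    prependList l g (l.length + m) = g m := by
  simp [prependList]

theorem crashed_prependList_subset {n : ℕ} (l : List (Fin n)) (g : ℕ → Fin n) :
    crashed (prependList l g) ⊆ crashed g := by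
  intro i hi
  refine Set.Finite.of_injOn (f := fun m => l.length + m) (t := {m | prependList l g m = i})
    ?_ ?_ hi
  · intro m hm
    simpa [prependList_add] using hm
  · intro a _ b _ h
    simpa using h

/-- A schedule in which exactly the processes of `W` take infinitely many steps. -/
def cyclicSchedule {n : ℕ} (W : Finset (Fin n)) (w : Fin n) : ℕ → Fin n :=
  fun m => if (⟨m % n, Nat.mod_lt _ w.pos⟩ : Fin n) ∈ W then ⟨m % n, Nat.mod_lt _ w.pos⟩ else w

theorem cyclicSchedule_mem {n : ℕ} (W : Finset (Fin n)) {w : Fin n} (hw : w ∈ W) (m : ℕ) :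
    cyclicSchedule W w m ∈ W := by
  unfold cyclicSchedule
  split <;> assumption

theorem cyclicSchedule_add_mul {n : ℕ} (W : Finset (Fin n)) (w : Fin n) {i : Fin n} (hi : i ∈ W)
    (m : ℕ) : cyclicSchedule W w (i + n * m) = i := by
  have : (⟨(i + n * m) % n, Nat.mod_lt _ w.pos⟩ : Fin n) = i := by
    apply Fin.ext
    simp [Nat.mod_eq_of_lt i.isLt]
  unfold cyclicSchedule
  rw [this, if_pos hi]

theorem crashed_cyclicSchedule_subset {n : ℕ} (W : Finset (Fin n)) (w : Fin n) :
    crashed (cyclicSchedule W w) ⊆ (↑Wᶜ : Set (Fin n)) := by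
  intro i hi
  simp only [Finset.coe_compl, Set.mem_compl_iff, Finset.mem_coe]
  intro hiW
  refine Set.infinite_of_injective_forall_mem (f := fun m => (i : ℕ) + n * m) ?_ ?_ hi
  · intro a b h
    have := w.pos
    simpa [this.ne'] using h
  · intro m
    exact cyclicSchedule_add_mul W w hiW m

namespace Algorithm

variable {n : ℕ} {A B V S : Type}

theorem agree_step (P : Algorithm n A B V S) {W : Finset (Fin n)} {c c' : GlobalState n V S}
    (h : c.Agree W c') {i : Fin n} (hi : i ∈ W) : (P.step c i).Agree W (P.step c' i) := by
  obtain ⟨hr, hl⟩ := h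
  have hi' := hl i hi
  unfold step
  rw [← hi']
  split
  · exact ⟨hr, hl⟩
  · refine ⟨by simp [hr], fun j hj => ?_⟩
    simp only [Function.update_apply]
    split
    · rfl
    · exact hl j hj
  · refine ⟨by simp [hr], fun j hj => ?_⟩
    simp only [Function.update_apply, hr]
    split
    · rfl
    · exact hl j hj

theorem agree_runFrom (P : Algorithm n A B V S) {W : Finset (Fin n)} {c c' : GlobalState n V S}
    (h : c.Agree W c') {l : List (Fin n)} (hl : ∀ i ∈ l, i ∈ W) :
    (P.runFrom c l).Agree W (P.runFrom c' l) := by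
  induction l generalizing c c' with
  | nil => exact h
  | cons i l ih =>
    exact ih (P.agree_step h (hl i List.mem_cons_self)) fun j hj => hl j (List.mem_cons_of_mem _ hj)

/-- The order of two steps of different processes is visible to at most one of the two. -/
theorem step_comm_agree (P : Algorithm n A B V S) (c : GlobalState n V S) {p q : Fin n}
    (h : p ≠ q) :
    ∃ r, (r = p ∨ r = q) ∧
      ∀ W : Finset (Fin n), r ∉ W → (P.step (P.step c p) q).Agree W (P.step (P.step c q) p) := by
  have hq : (P.step c p).loc q = c.loc q := P.step_loc_of_ne c h.symm
  have hp : (P.step c q).loc p = c.loc p := P.step_loc_of_ne c h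
  have key : ∀ r, (∀ j, (P.step (P.step c p) q).reg j = (P.step (P.step c q) p).reg j) →
      (∀ j, j ≠ r → (P.step (P.step c p) q).loc j = (P.step (P.step c q) p).loc j) →
      ∀ W : Finset (Fin n), r ∉ W →
        (P.step (P.step c p) q).Agree W (P.step (P.step c q) p) := by
    intro r h1 h2 W hW
    exact ⟨funext h1, fun j hj => h2 j fun e => hW (e ▸ hj)⟩
  rcases hip : P.instr p (c.loc p) with _ | ⟨v, s⟩ | ⟨j, g⟩ <;>
    rcases hiq : P.instr q (c.loc q) with _ | ⟨v', s'⟩ | ⟨j', g'⟩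
  -- Registers have a single writer, so the order matters only if one process reads what the other
  -- writes, and only the reader notices. Here the reader can be `q`; in all other cases `p` serves
  -- as the exception.
  case write.read =>
    refine ⟨q, Or.inr rfl, key q ?_ ?_⟩ <;>
    · intro k
      simp only [step, hip, hiq, Function.update_apply, h, h.symm, if_false]
      try grind
  all_goals
    refine ⟨p, Or.inl rfl, key p ?_ ?_⟩ <;>
    · intro k
      simp only [step, hip, hiq, Function.update_apply, h, h.symm, if_false]
      try grind

/-- As long as no more than `t` processes are outside `W`, the processes of `W` decide on their
own after every finite execution. -/
theorem Solves.exists_decided {P : Algorithm n A B V S} {T : DistTask n A B} {t : ℕ}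
    (hP : P.Solves T t) {σ : Fin n → A} (hσ : σ ∈ T.inputs) {W : Finset (Fin n)}
    (hW : W.Nonempty) (ht : Wᶜ.card ≤ t) (l : List (Fin n)) :
    ∃ l' : List (Fin n), (∀ i ∈ l', i ∈ W) ∧
      (∀ i ∈ W, P.output i ((P.runFrom (P.initial σ) (l ++ l')).loc i) ≠ none) ∧
      P.outConfig (P.runFrom (P.initial σ) (l ++ l')) ∈ T.Δ σ := by
  obtain ⟨w, hw⟩ := hW
  have hc : crashed (prependList l (cyclicSchedule W w)) ⊆ (↑Wᶜ : Set (Fin n)) :=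
    (crashed_prependList_subset _ _).trans (crashed_cyclicSchedule_subset W w)
  obtain ⟨τ, hτ, hdec, hev⟩ := hP σ hσ (prependList l (cyclicSchedule W w)) (by
    refine (Set.ncard_le_ncard hc (Set.toFinite _)).trans ?_
    rwa [Set.ncard_coe_finset])
  obtain ⟨N, hN⟩ := Filter.eventually_atTop.1 hev
  have h1 := hN (l.length + N) (Nat.le_add_left _ _)
  rw [run_eq_runFrom, map_range_prependList] at h1
  refine ⟨(List.range N).map (cyclicSchedule W w), ?_, ?_, ?_⟩
  · intro i hi
    obtain ⟨m, -, rfl⟩ := List.mem_map.1 hi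
    exact cyclicSchedule_mem W hw m
  · intro i hi
    have h2 := hdec i (fun h => by simpa [hi] using hc h)
    rwa [← h1] at h2
  · rw [h1]
    exact hτ

/-- The decisions taken in a finite execution are legal. -/
theorem Solves.outConfig_mem [NeZero n] {P : Algorithm n A B V S} {T : DistTask n A B} {t : ℕ}
    (hP : P.Solves T t) {σ : Fin n → A} (hσ : σ ∈ T.inputs) (l : List (Fin n)) :
    P.outConfig (P.runFrom (P.initial σ) l) ∈ T.Δ σ := by
  -- Extend the execution to one without crashes; the decisions taken so far are a face of the final
  -- ones.
  obtain ⟨l', -, -, h⟩ := hP.exists_decided hσ (W := Finset.univ) Finset.univ_nonempty (by simp) l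
  refine T.Δ_face σ hσ _ h _ fun i y hy => ?_
  rw [runFrom_append]
  exact P.output_runFrom _ l' i y hy

/-! ### Valency and the bivalence argument. -/

/-- Some execution of the processes of `Q` from `c` leads to a decision of class `b`. -/
def Reaches (P : Algorithm n A B V S) (Q : Finset (Fin n)) (val : B → Bool)
    (c : GlobalState n V S) (b : Bool) : Prop :=
  ∃ l : List (Fin n), (∀ i ∈ l, i ∈ Q) ∧
    ∃ i ∈ Q, ∃ y, P.output i ((P.runFrom c l).loc i) = some y ∧ val y = b

theorem Reaches.of_runFrom {P : Algorithm n A B V S} {Q : Finset (Fin n)} {val : B → Bool}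
    {c : GlobalState n V S} {b : Bool} {l : List (Fin n)} (hl : ∀ i ∈ l, i ∈ Q)
    (h : P.Reaches Q val (P.runFrom c l) b) : P.Reaches Q val c b := by
  obtain ⟨l', hl', h'⟩ := h
  refine ⟨l ++ l', ?_, ?_⟩
  · intro i hi
    exact (List.mem_append.1 hi).elim (hl i) (hl' i)
  · rwa [runFrom_append]

/-- Two global states that `W` cannot distinguish, where at most `t` processes are outside `W`,
have a common reachable decision. -/
theorem Solves.exists_reaches_of_agree {P : Algorithm n A B V S} {T : DistTask n A B} {t : ℕ}
    (hP : P.Solves T t) {Q : Finset (Fin n)} (val : B → Bool) {σ : Fin n → A} (hσ : σ ∈ T.inputs)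
    {W : Finset (Fin n)} (hWQ : W ⊆ Q) (hW : W.Nonempty) (ht : Wᶜ.card ≤ t) (l : List (Fin n))
    {c' : GlobalState n V S} (h : (P.runFrom (P.initial σ) l).Agree W c') :
    ∃ b, P.Reaches Q val (P.runFrom (P.initial σ) l) b ∧ P.Reaches Q val c' b := by
  obtain ⟨l', hl', hdec, -⟩ := hP.exists_decided hσ hW ht l
  obtain ⟨w, hw⟩ := hW
  obtain ⟨y, hy⟩ := Option.ne_none_iff_exists'.1 (hdec w hw)
  rw [runFrom_append] at hy
  refine ⟨val y, ⟨l', fun i hi => hWQ (hl' i hi), w, hWQ hw, y, hy, rfl⟩,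
    ⟨l', fun i hi => hWQ (hl' i hi), w, hWQ hw, y, ?_, rfl⟩⟩
  rwa [← (P.agree_runFrom h hl').2 w hw]

/-- Both classes of decisions can be reached from `c` by the processes of `Q`. -/
def Bivalent (P : Algorithm n A B V S) (Q : Finset (Fin n)) (val : B → Bool)
    (c : GlobalState n V S) : Prop :=
  ∀ b, P.Reaches Q val c b

/-- From a bivalent state one can reach a bivalent state by an execution that ends with a step of
a given process. -/
theorem Solves.exists_bivalent_step {P : Algorithm n A B V S} {T : DistTask n A B} {t : ℕ}
    (hP : P.Solves T t) {Q : Finset (Fin n)} (val : B → Bool) {σ : Fin n → A} (hσ : σ ∈ T.inputs)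
    (hQ : 2 ≤ Q.card) (ht : Qᶜ.card + 1 ≤ t) (l : List (Fin n))
    (hb : P.Bivalent Q val (P.runFrom (P.initial σ) l)) {p : Fin n} (hp : p ∈ Q) :
    ∃ l' : List (Fin n), (∀ i ∈ l', i ∈ Q) ∧
      P.Bivalent Q val (P.runFrom (P.initial σ) (l ++ (l' ++ [p]))) := by
  by_contra! hcon
  set c := P.runFrom (P.initial σ) l with hc
  have huni : ∀ l' : List (Fin n), (∀ i ∈ l', i ∈ Q) →
      ∃ b, ¬ P.Reaches Q val (P.runFrom c (l' ++ [p])) b := by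
    intro l' hl'
    have := hcon l' hl'
    rw [runFrom_append] at this
    simpa only [Bivalent, not_forall] using this
  -- `b` is the class lost if `p` moves at once. It is shown to stay lost however long the step of
  -- `p` is delayed, although `l₁` reaches it.
  obtain ⟨b, hb0⟩ := huni [] (by simp)
  obtain ⟨l₁, hl₁, i, hi, y, hy, hyb⟩ := hb b
  have key : ∀ l' : List (Fin n), (∀ i ∈ l', i ∈ Q) →
      ¬ P.Reaches Q val (P.runFrom c (l' ++ [p])) b := by
    intro l'
    induction l' using List.reverseRecOn with
    | nil => exact fun _ => hb0
    | append_singleton l' q ih =>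
      intro hl' hr
      have hl'' : ∀ i ∈ l', i ∈ Q := fun i hi => hl' i (by simp [hi])
      have hq : q ∈ Q := hl' q (by simp)
      specialize ih hl''
      by_cases hqp : q = p
      · subst hqp
        rw [runFrom_append] at hr
        exact ih (hr.of_runFrom (by simpa using hq))
      · obtain ⟨b', hb'⟩ := huni _ hl'
        obtain ⟨r, hr', hag⟩ := P.step_comm_agree (P.runFrom c l') (Ne.symm hqp)
        have hrQ : r ∈ Q := by rcases hr' with rfl | rfl <;> assumption
        -- Crashing `r` leaves processes that cannot tell `p, q` from `q, p`, so the two orders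
        -- share a reachable class `b''`.
        have hag' := hag (Q.erase r) (by simp)
        have e1 : P.step (P.step (P.runFrom c l') p) q =
            P.runFrom (P.initial σ) (l ++ (l' ++ [p, q])) := by
          simp [runFrom_append, hc]
        rw [e1] at hag'
        obtain ⟨b'', h1, h2⟩ := hP.exists_reaches_of_agree (Q := Q) val hσ (Finset.erase_subset r Q)
          (by rw [← Finset.card_pos, Finset.card_erase_of_mem hrQ]; omega)
          (by
            rw [Finset.card_compl] at ht ⊢
            rw [Finset.card_erase_of_mem hrQ]; omega) _ hag'
        have h3 : P.Reaches Q val (P.runFrom c (l' ++ [p])) b'' := by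
          apply Reaches.of_runFrom (l := [q]) (by simpa using hq)
          simpa [runFrom_append, hc] using h1
        have h4 : P.Reaches Q val (P.runFrom c (l' ++ [q] ++ [p])) b'' := by
          simpa [runFrom_append] using h2
        have n1 : b'' ≠ b := fun e => ih (e ▸ h3)
        have n2 : b'' ≠ b' := fun e => hb' (e ▸ h4)
        have n3 : b ≠ b' := fun e => hb' (e ▸ hr)
        -- Three pairwise distinct Booleans do not exist.
        revert n1 n2 n3
        cases b <;> cases b' <;> cases b'' <;> simp
  refine key l₁ hl₁ ⟨[], by simp, i, hi, y, ?_, hyb⟩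
  rw [runFrom_nil, runFrom_append]
  exact P.output_runFrom _ _ _ _ hy

end Algorithm

/-- A sequence of lists that strictly extend each other has a limit. -/
theorem exists_limit_of_prefix {α : Type} [Inhabited α] (L : ℕ → List α)
    (hpre : ∀ k, L k <+: L (k + 1)) (hlen : ∀ k, (L k).length < (L (k + 1)).length) :
    ∃ g : ℕ → α, ∀ k, (List.range (L k).length).map g = L k := by
  have hmono : ∀ a b, a ≤ b → L a <+: L b := fun a b h => by
    induction b, h using Nat.le_induction with
    | base => exact List.prefix_rfl
    | succ b _ ih => exact ih.trans (hpre b)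
  have hge : ∀ k, k ≤ (L k).length := fun k => (strictMono_nat_of_lt_succ hlen).le_apply
  -- `L (m + 1)` has more than `m` entries, so the default is never used.
  refine ⟨fun m => (L (m + 1)).getD m default, fun k => ?_⟩
  apply List.ext_getElem
  · simp
  · intro m h1 h2
    simp only [List.getElem_map, List.getElem_range]
    have h3 : m < (L (m + 1)).length := hge (m + 1)
    rw [List.getD_eq_getElem _ _ h3]
    rcases le_total k (m + 1) with h | h
    · exact ((hmono _ _ h).getElem h2).symm
    · exact (hmono _ _ h).getElem h3

namespace Algorithm

variable {n : ℕ} {A B V S : Type}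

/-- From a bivalent initial state one reaches a state in which decisions of both classes have
been taken. -/
theorem Solves.exists_disagreement_of_bivalent {P : Algorithm n A B V S} {T : DistTask n A B}
    {t : ℕ} (hP : P.Solves T t) {Q : Finset (Fin n)} (val : B → Bool) {σ : Fin n → A}
    (hσ : σ ∈ T.inputs) (hQ : 2 ≤ Q.card) (ht : Qᶜ.card + 1 ≤ t)
    (hb : P.Bivalent Q val (P.initial σ)) :
    ∃ l : List (Fin n), (∀ i ∈ l, i ∈ Q) ∧ ∃ i ∈ Q, ∃ j ∈ Q, ∃ y z,
      P.output i ((P.runFrom (P.initial σ) l).loc i) = some y ∧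
      P.output j ((P.runFrom (P.initial σ) l).loc j) = some z ∧ val y ≠ val z := by
  obtain ⟨w, hw⟩ : Q.Nonempty := by rw [← Finset.card_pos]; omega
  have : Inhabited (Fin n) := ⟨w⟩
  -- Bivalent executions are extended forever, the `k`-th extension ending with a step of the `k`-th
  -- process of the cyclic schedule. In the limit no process of `Q` crashes.
  let X := {l : List (Fin n) // (∀ i ∈ l, i ∈ Q) ∧ P.Bivalent Q val (P.runFrom (P.initial σ) l)}
  have hstep : ∀ (x : X) (m : ℕ), ∃ x' : X, ∃ l', x'.1 = x.1 ++ (l' ++ [cyclicSchedule Q w m]) := by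
    intro x m
    have hm := cyclicSchedule_mem Q hw m
    obtain ⟨l', hl', h⟩ := hP.exists_bivalent_step val hσ hQ ht x.1 x.2.2 hm
    refine ⟨⟨_, ?_, h⟩, l', rfl⟩
    intro i hi
    simp only [List.mem_append, List.mem_singleton] at hi
    rcases hi with hi | hi | rfl
    · exact x.2.1 i hi
    · exact hl' i hi
    · exact hm
  choose next ext hext using hstep
  let L : ℕ → X := fun k => Nat.rec ⟨[], by simp, hb⟩ (fun m x => next x m) k
  have hL : ∀ k, (L (k + 1)).1 = (L k).1 ++ (ext (L k) k ++ [cyclicSchedule Q w k]) :=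
    fun k => hext (L k) k
  have hlen : ∀ k, (L k).1.length < (L (k + 1)).1.length := by
    intro k; rw [hL]; simp
  have hsm : StrictMono fun k => (L k).1.length := strictMono_nat_of_lt_succ hlen
  obtain ⟨g, hg⟩ := exists_limit_of_prefix (fun k => (L k).1)
    (fun k => by rw [hL]; exact List.prefix_append _ _) hlen
  have hlast : ∀ k, g ((L (k + 1)).1.length - 1) = cyclicSchedule Q w k := by
    intro k
    have h1 : (L (k + 1)).1.length - 1 < (L (k + 1)).1.length := by have := hlen k; omega
    have h2 : (L (k + 1)).1.getLast? = some (cyclicSchedule Q w k) := by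
      rw [hL, ← List.append_assoc, List.getLast?_concat]
    have h3 := congrArg (fun l => l[(L (k + 1)).1.length - 1]?) (hg (k + 1))
    simp only [← List.getLast?_eq_getElem?] at h3
    rw [h2] at h3
    simpa [h1] using h3
  have hcr : crashed g ⊆ (↑Qᶜ : Set (Fin n)) := by
    intro i hi
    simp only [Finset.coe_compl, Set.mem_compl_iff, Finset.mem_coe]
    intro hiQ
    refine Set.infinite_of_injective_forall_mem
      (f := fun m => (L ((i + n * m) + 1)).1.length - 1) ?_ ?_ hi
    · intro a b h
      have h1 := hlen (i + n * a)
      have h2 := hlen (i + n * b)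
      have h3 := hsm.injective (a₁ := i + n * a + 1) (a₂ := i + n * b + 1)
        (by simp only at h ⊢; omega)
      have := w.pos
      simpa [this.ne'] using h3
    · intro m
      exact (hlast _).trans (cyclicSchedule_add_mul Q w hiQ m)
  obtain ⟨τ, -, hdec, hev⟩ := hP σ hσ g (by
    refine (Set.ncard_le_ncard hcr (Set.toFinite _)).trans ?_
    rw [Set.ncard_coe_finset]; omega)
  obtain ⟨N, hN⟩ := Filter.eventually_atTop.1 hev
  have h1 := hN _ (hsm.le_apply (x := N))
  rw [run_eq_runFrom, hg] at h1
  have h2 := hdec w (fun h => by simpa [hw] using hcr h)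
  rw [← h1] at h2
  obtain ⟨y, hy⟩ := Option.ne_none_iff_exists'.1 h2
  -- `w` has already decided `y` in a state that is still bivalent, so the opposite class can be
  -- reached as well.
  obtain ⟨l', hl', i, hi, z, hz, hzb⟩ := (L N).2.2 (!val y)
  refine ⟨(L N).1 ++ l', ?_, w, hw, i, hi, y, z, ?_, ?_, ?_⟩
  · intro i hi
    exact (List.mem_append.1 hi).elim ((L N).2.1 i) (hl' i)
  · rw [runFrom_append]
    exact P.output_runFrom _ _ _ _ hy
  · rwa [runFrom_append]
  · rw [hzb]; simp

/-- If the processes of `Q`, one of which may crash, can only reach decisions of class `false` on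
inputs `σ₀` and of class `true` on inputs `σ₁`, then they take decisions of both classes in some
execution. -/
theorem Solves.exists_disagreement {P : Algorithm n A B V S} {T : DistTask n A B}
    {t : ℕ} (hP : P.Solves T t) {Q : Finset (Fin n)} (val : B → Bool) (hT : T.inputs = Set.univ)
    (hQ : 2 ≤ Q.card) (ht : Qᶜ.card + 1 ≤ t) (σ₀ σ₁ : Fin n → A)
    (hσ : ∀ i, i ∉ Q → σ₁ i = σ₀ i)
    (h₀ : ¬ P.Reaches Q val (P.initial σ₀) true) (h₁ : ¬ P.Reaches Q val (P.initial σ₁) false) :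
    ∃ σ : Fin n → A, (∀ i, i ∉ Q → σ i = σ₀ i) ∧
    ∃ l : List (Fin n), (∀ i ∈ l, i ∈ Q) ∧ ∃ i ∈ Q, ∃ j ∈ Q, ∃ y z,
      P.output i ((P.runFrom (P.initial σ) l).loc i) = some y ∧
      P.output j ((P.runFrom (P.initial σ) l).loc j) = some z ∧ val y ≠ val z := by
  have hin : ∀ σ, σ ∈ T.inputs := fun σ => hT ▸ Set.mem_univ σ
  suffices ∃ σ : Fin n → A, (∀ i, i ∉ Q → σ i = σ₀ i) ∧ P.Bivalent Q val (P.initial σ) by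
    obtain ⟨σ, h1, h2⟩ := this
    exact ⟨σ, h1, hP.exists_disagreement_of_bivalent val (hin σ) hQ ht h2⟩
  by_contra! hcon
  -- Inputs are switched from `σ₀` to `σ₁` one process at a time. If that process `p` crashes,
  -- neighbouring initial states look alike and share a class; without a bivalent one the class
  -- `true` never becomes reachable.
  have key : ∀ X : Finset (Fin n), X ⊆ Q →
      ¬ P.Reaches Q val (P.initial (X.piecewise σ₁ σ₀)) true := by
    intro X
    induction X using Finset.induction_on with
    | empty => intro _; simpa using h₀
    | insert p X hpX ih =>
      intro hX htrue
      have hpQ : p ∈ Q := hX (Finset.mem_insert_self _ _)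
      have hag : (P.runFrom (P.initial (X.piecewise σ₁ σ₀)) []).Agree (Q.erase p)
          (P.initial ((insert p X).piecewise σ₁ σ₀)) := by
        refine ⟨rfl, fun i hi => ?_⟩
        have : i ≠ p := (Finset.mem_erase.1 hi).1
        simp [initial, this, Finset.piecewise]
      obtain ⟨b, h1, h2⟩ := hP.exists_reaches_of_agree (Q := Q) val (hin _)
        (Finset.erase_subset p Q)
        (by rw [← Finset.card_pos, Finset.card_erase_of_mem hpQ]; omega)
        (by
          rw [Finset.card_compl] at ht ⊢
          rw [Finset.card_erase_of_mem hpQ]; omega) [] hag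
      cases b
      · refine hcon ((insert p X).piecewise σ₁ σ₀) (fun i hi => ?_) fun b => ?_
        · exact Finset.piecewise_eq_of_notMem _ _ _ fun h => hi (hX h)
        · cases b <;> assumption
      · exact ih ((Finset.subset_insert _ _).trans hX) h1
  have hQ1 : Q.piecewise σ₁ σ₀ = σ₁ := by
    ext i
    by_cases hi : i ∈ Q
    · simp [hi]
    · simp [hi, hσ]
  have hk := key Q subset_rfl
  rw [hQ1] at hk
  obtain ⟨b, h, -⟩ := hP.exists_reaches_of_agree (Q := Q) (W := Q) val (hin σ₁) subset_rfl
    (by rw [← Finset.card_pos]; omega) (by omega) [] (c' := P.initial σ₁) ⟨rfl, fun _ _ => rfl⟩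
  cases b
  · exact h₁ h
  · exact hk h

end Algorithm

/-! ### Lower bound for approximate agreement. -/

/-- A decision that the processes of `Q` take on their own is their common input, if they have one. -/
theorem Algorithm.Solves.output_eq_of_input_eq {n k t : ℕ} [NeZero n] {V S : Type}
    {P : Algorithm n (Fin 2) ℚ V S} (hP : P.Solves (approxAgreement n k) t) {Q : Finset (Fin n)}
    {σ : Fin n → Fin 2} {x : Fin 2} (hσ : ∀ i ∈ Q, σ i = x) {l : List (Fin n)}
    (hl : ∀ i ∈ l, i ∈ Q) {i : Fin n} (hi : i ∈ Q) {y : ℚ}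
    (hy : P.output i ((P.runFrom (P.initial σ) l).loc i) = some y) : y = ((x : ℕ) : ℚ) := by
  -- Processes outside `Q` take no steps, so their inputs are invisible and may be changed to `x`.
  have hag : (P.initial σ).Agree Q (P.initial fun _ => x) :=
    ⟨rfl, fun i hi => by simp [Algorithm.initial, hσ i hi]⟩
  have h := hP.outConfig_mem (σ := fun _ => x) (Set.mem_univ _) l
  refine h.2.1 x (fun _ => rfl) i y ?_
  rw [← hy]
  exact congrArg (P.output i) ((P.agree_runFrom hag hl).2 i hi).symm

/-- Processes that tolerate the crash of one of them take decisions `m / k` and `(m + 1) / k`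
in some execution. -/
theorem Algorithm.Solves.exists_adjacent_outputs {n k t : ℕ} [NeZero n] {V S : Type}
    {P : Algorithm n (Fin 2) ℚ V S} (hP : P.Solves (approxAgreement n k) t) {Q : Finset (Fin n)}
    (hQ : 2 ≤ Q.card) (ht : Qᶜ.card + 1 ≤ t) {m : ℕ} (hm : m < k) :
    ∃ σ : Fin n → Fin 2, (∀ i, i ∉ Q → σ i = 0) ∧ ∃ l : List (Fin n), (∀ i ∈ l, i ∈ Q) ∧
      ∃ i j : Fin n, P.output i ((P.runFrom (P.initial σ) l).loc i) = some ((m : ℚ) / k) ∧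
        P.output j ((P.runFrom (P.initial σ) l).loc j) = some (((m : ℚ) + 1) / k) := by
  have hk : (0 : ℚ) < k := by exact_mod_cast (Nat.zero_le m).trans_lt hm
  obtain ⟨σ, hσ, l, hl, i, hi, j, hj, y, z, hy, hz, hne⟩ := hP.exists_disagreement
    (fun y => decide ((m : ℚ) / k < y)) rfl hQ ht (fun _ => 0) (Q.piecewise (fun _ => 1) fun _ => 0)
    (fun i hi => by simp [hi])
    (by
      rintro ⟨l, hl, i, hi, y, hy, hlt⟩
      have := hP.output_eq_of_input_eq (fun _ _ => rfl) hl hi hy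
      subst this
      have : (0 : ℚ) ≤ (m : ℚ) / k := by positivity
      simp at hlt
      linarith)
    (by
      rintro ⟨l, hl, i, hi, y, hy, hlt⟩
      have := hP.output_eq_of_input_eq (x := 1) (fun i hi => by simp [hi]) hl hi hy
      subst this
      simp only [decide_eq_false_iff_not, not_lt, le_div_iff₀ hk] at hlt
      have : (m : ℚ) < k := by exact_mod_cast hm
      simp at hlt
      linarith)
  refine ⟨σ, hσ, l, hl, ?_⟩
  have hleg := hP.outConfig_mem (σ := σ) (Set.mem_univ _) l
  -- Two grid points on different sides of the threshold and at distance at most `1 / k` are the two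
  -- points next to it.
  have key : ∀ (i j : Fin n) (y z : ℚ), P.output i ((P.runFrom (P.initial σ) l).loc i) = some y →
      P.output j ((P.runFrom (P.initial σ) l).loc j) = some z → (m : ℚ) / k < z →
      y ≤ (m : ℚ) / k → y = (m : ℚ) / k ∧ z = ((m : ℚ) + 1) / k := by
    intro i j y z hy hz h1 h2
    obtain ⟨a, -, rfl⟩ := hleg.1 i y hy
    obtain ⟨b, -, rfl⟩ := hleg.1 j z hz
    have h3 := (abs_le.1 (hleg.2.2 i j _ _ hy hz)).1
    rw [div_lt_div_iff_of_pos_right hk] at h1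
    rw [div_le_div_iff_of_pos_right hk] at h2
    have h4 : (b : ℚ) ≤ a + 1 := by
      have : (b : ℚ) / k ≤ (a + 1) / k := by rw [add_div]; linarith
      rwa [div_le_div_iff_of_pos_right hk] at this
    norm_cast at h1 h2 h4
    have h5 : a = m := by omega
    have h6 : b = m + 1 := by omega
    subst h5 h6
    simp
  by_cases h : (m : ℚ) / k < z
  · have h' : y ≤ (m : ℚ) / k := by
      by_contra! h''
      simp [h, h''] at hne
    obtain ⟨rfl, rfl⟩ := key i j y z hy hz h h'
    exact ⟨i, j, hy, hz⟩
  · have h' : (m : ℚ) / k < y := by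
      by_contra! h''
      simp [h, h''.not_gt] at hne
    obtain ⟨rfl, rfl⟩ := key j i z y hz hy h' (not_lt.1 h)
    exact ⟨j, i, hz, hy⟩

/-- With registers with finitely many contents the precision of approximate agreement is bounded
by the number of contents of `n - t + 1` registers. -/
theorem not_solvable_approxAgreement {n t : ℕ} (V : Type) [Fintype V] (hn : n < 2 * t)
    (htn : t < n) :
    ¬ Solvable V t (approxAgreement n (2 * Fintype.card V ^ (n - t + 1) + 1)) := by
  rintro ⟨S, P, hP⟩
  have : NeZero n := ⟨by omega⟩
  set M := Fintype.card V ^ (n - t + 1) with hM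
  obtain ⟨Q, -, hQ⟩ := Finset.exists_subset_card_eq (s := (Finset.univ : Finset (Fin n)))
    (n := n - t + 1) (by simp; omega)
  have hQc : Qᶜ.card + 1 = t := by rw [Finset.card_compl, hQ, Fintype.card_fin]; omega
  have hex := fun a : Fin (M + 1) =>
    hP.exists_adjacent_outputs (Q := Q) (by omega) hQc.le (m := 2 * a) (by omega)
  choose σ hσ l hl p q hp hq using hex
  let mem : Fin (M + 1) → (Q → V) := fun a i => (P.runFrom (P.initial (σ a)) (l a)).reg i
  obtain ⟨a, b, hab, hmem⟩ := Fintype.exists_ne_map_eq_of_card_lt mem (by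
    classical
    simp [hQ, hM])
  wlog hlt : a < b generalizing a b
  · exact this b a hab.symm hmem.symm (lt_of_le_of_ne (not_lt.1 hlt) hab.symm)
  have hag : (P.runFrom (P.initial (σ a)) (l a)).Agree Qᶜ
      (P.runFrom (P.initial (σ b)) (l b)) := by
    constructor
    · funext i
      by_cases hi : i ∈ Q
      · exact congrFun hmem ⟨i, hi⟩
      · rw [P.runFrom_reg_of_notMem _ i _ fun h => hi (hl a i h),
          P.runFrom_reg_of_notMem _ i _ fun h => hi (hl b i h)]
        rfl
    · intro i hi
      rw [Finset.mem_compl] at hi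
      rw [P.runFrom_loc_of_notMem _ i _ fun h => hi (hl a i h),
        P.runFrom_loc_of_notMem _ i _ fun h => hi (hl b i h)]
      simp [Algorithm.initial, hσ a i hi, hσ b i hi]
  obtain ⟨w, hw⟩ : Qᶜ.Nonempty := by rw [← Finset.card_pos]; omega
  -- The processes outside `Q` run alone, as if all of `Q` had crashed; `n < 2 * t` gives `Q.card ≤
  -- t`.
  obtain ⟨l', hl', hdec, hlega⟩ := hP.exists_decided (σ := σ a) (Set.mem_univ _) ⟨w, hw⟩
    (by rw [compl_compl]; omega) (l a)
  have hlegb := hP.outConfig_mem (σ := σ b) (Set.mem_univ _) (l b ++ l')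
  obtain ⟨v, hv⟩ := Option.ne_none_iff_exists'.1 (hdec w hw)
  rw [P.runFrom_append] at hv hlega hlegb
  have hv' := hv
  rw [(P.agree_runFrom hag hl').2 w hw] at hv'
  have h1 := hlega.2.2 w (p a) v _ hv (P.output_runFrom _ l' _ _ (hp a))
  have h2 := hlegb.2.2 w (q b) v _ hv' (P.output_runFrom _ l' _ _ (hq b))
  have h3 := (abs_le.1 h1).2
  have h4 := (abs_le.1 h2).1
  have hk : (0 : ℚ) < ((2 * M + 1 : ℕ) : ℚ) := by positivity
  -- Comparing `v` with `2 * a / k` and `(2 * b + 1) / k` gives `2 * b + 1 ≤ 2 * a + 2`. The even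
  -- spacing of the thresholds makes this contradict `a < b`.
  have h5 : ((2 * (b : ℕ) : ℕ) + 1 : ℚ) / ((2 * M + 1 : ℕ) : ℚ) ≤
      ((2 * (a : ℕ) : ℕ) + 1 + 1 : ℚ) / ((2 * M + 1 : ℕ) : ℚ) := by
    rw [add_div _ (1 : ℚ), add_div _ (1 : ℚ), add_div _ (1 : ℚ)] at *
    linarith
  rw [div_le_div_iff_of_pos_right hk] at h5
  norm_cast at h5
  have : (a : ℕ) < b := hlt
  omega

/-! ### The midpoint algorithm. -/

/-- A word that encodes a finite list of rational numbers. -/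
def encodeWord (l : List ℚ) : UnboundedReg := List.replicate (Encodable.encode l) true

/-- The list of rational numbers that a word encodes. -/
def decodeWord (v : UnboundedReg) : List ℚ := (Encodable.decode v.length).getD []

@[simp] theorem decodeWord_encodeWord (l : List ℚ) : decodeWord (encodeWord l) = l := by
  simp [decodeWord, encodeWord]

/-- The local state of a process in the midpoint algorithm: the list of its estimates in all rounds
so far, the position `pc` in the current round (`0` before the last estimate has been published, and
`j + 1` before register `j` is read), and the least and the greatest estimate collected in the
current round. -/
structure MidpointState where
  hist : List ℚ
  pc : ℕ
  lo : ℚ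
  hi : ℚ

namespace MidpointState

/-- The state after the last estimate has been published. -/
def startCollect (s : MidpointState) : MidpointState :=
  ⟨s.hist, 1, s.hist.getLastD 0, s.hist.getLastD 0⟩

/-- The state after a list of estimates of some process has been read. -/
def absorb (n : ℕ) (s : MidpointState) (l : List ℚ) : MidpointState :=
  -- The current round is `s.hist.length - 1`. A process that has not published in it contributes
  -- nothing, by the choice of default; one that is ahead still shows its estimate of this round.
  let lo := min s.lo (l.getD (s.hist.length - 1) s.lo)
  let hi := max s.hi (l.getD (s.hist.length - 1) s.hi)
  if s.pc < n then ⟨s.hist, s.pc + 1, lo, hi⟩ else ⟨s.hist ++ [(lo + hi) / 2], 0, lo, hi⟩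

end MidpointState

/-- In each of `R` rounds every process publishes its estimate, collects all estimates of this round
that have been published, and moves to the midpoint of the least and the greatest of them. After the
last round the estimate is rounded down to a multiple of `1 / k`. -/
def midpointAlgorithm (n R k : ℕ) : Algorithm n (Fin 2) ℚ UnboundedReg MidpointState where
  initReg _ := encodeWord []
  start _ x := ⟨[((x : ℕ) : ℚ)], 0, 0, 0⟩
  instr _ s :=
    if R < s.hist.length then Instr.halt
    else if s.pc = 0 then Instr.write (encodeWord s.hist) s.startCollect
    else if h : s.pc - 1 < n then Instr.read ⟨s.pc - 1, h⟩ fun v => s.absorb n (decodeWord v)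
    else Instr.halt
  output _ s :=
    if R < s.hist.length then some ((⌊(k : ℚ) * s.hist.getD R 0⌋₊ : ℚ) / (k : ℚ)) else none
  output_write i s y v s' h := by
    intro h'
    split at h <;> simp_all
  output_read i s y j g h := by
    intro h'
    split at h <;> simp_all

theorem midpointAlgorithm_haltsOnDecision (n R k : ℕ) :
    (midpointAlgorithm n R k).HaltsOnDecision := by
  intro i s h
  simp only [midpointAlgorithm] at h ⊢
  split at h <;> simp_all

namespace GlobalState

variable {n : ℕ}

/-- The estimates of process `i`. -/
abbrev hist (c : GlobalState n UnboundedReg MidpointState) (i : Fin n) : List ℚ := (c.loc i).hist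

/-- The published estimates of process `i`. -/
abbrev published (c : GlobalState n UnboundedReg MidpointState) (i : Fin n) : List ℚ :=
  decodeWord (c.reg i)

/-- The basic invariant of the midpoint algorithm. -/
def WellFormed (c : GlobalState n UnboundedReg MidpointState) : Prop :=
  ∀ i, c.hist i ≠ [] ∧ (c.loc i).pc ≤ n ∧ c.published i <+: c.hist i ∧
    ((c.loc i).pc ≠ 0 → c.published i = c.hist i)

end GlobalState

/-! ### Invariants of the midpoint algorithm. -/

section Midpoint

variable {n R k : ℕ}

/-- The bound `pc ≤ n` in `WellFormed` excludes the last `halt` branch of the program. -/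
theorem midpoint_step_cases {c : GlobalState n UnboundedReg MidpointState} (hc : c.WellFormed)
    (i : Fin n) :
    (R < (c.hist i).length ∧ (midpointAlgorithm n R k).step c i = c) ∨
    ((c.loc i).pc = 0 ∧ (midpointAlgorithm n R k).step c i =
      ⟨Function.update c.reg i (encodeWord (c.hist i)),
        Function.update c.loc i (c.loc i).startCollect⟩) ∨
    (∃ j : Fin n, (c.loc i).pc = j + 1 ∧ (midpointAlgorithm n R k).step c i =
      ⟨c.reg, Function.update c.loc i ((c.loc i).absorb n (c.published j))⟩) := by
  by_cases h1 : R < (c.hist i).length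
  · left
    simp [Algorithm.step, midpointAlgorithm, h1]
  by_cases h2 : (c.loc i).pc = 0
  · right; left
    simp [Algorithm.step, midpointAlgorithm, h1, h2]
  · right; right
    have h3 : (c.loc i).pc - 1 < n := by
      have := (hc i).2.1
      omega
    refine ⟨⟨(c.loc i).pc - 1, h3⟩, by simp; omega, ?_⟩
    simp [Algorithm.step, midpointAlgorithm, h1, h2, h3]

theorem MidpointState.hist_prefix_absorb (s : MidpointState) (l : List ℚ) :
    s.hist <+: (s.absorb n l).hist := by
  unfold absorb
  simp only
  split <;> simp

theorem GlobalState.WellFormed.step {c : GlobalState n UnboundedReg MidpointState}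
    (hc : c.WellFormed) (i : Fin n) : ((midpointAlgorithm n R k).step c i).WellFormed := by
  intro j
  by_cases hij : j = i
  · subst hij
    obtain ⟨h1, h2, h3, h4⟩ := hc j
    have hn := j.pos
    rcases midpoint_step_cases (R := R) (k := k) hc j with ⟨-, h⟩ | ⟨-, h⟩ | ⟨q, hq, h⟩
    · rw [h]; exact hc j
    · rw [h]
      simp [hist, published, MidpointState.startCollect, h1]
      omega
    · rw [h]
      have h5 := h4 (by omega)
      have hp := (c.loc j).hist_prefix_absorb (n := n) (c.published q)
      refine ⟨?_, ?_, ?_, ?_⟩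
      · simp only [hist, Function.update_self]
        exact fun e => h1 (List.prefix_nil.1 (e ▸ hp))
      · simp only [Function.update_self, MidpointState.absorb]
        split
        · simp; omega
        · simp
      · simp only [hist, published, Function.update_self] at h5 ⊢
        rwa [h5]
      · simp only [hist, published, Function.update_self, MidpointState.absorb] at h5 ⊢
        split
        · simpa using h5
        · simp
  · have hl := (midpointAlgorithm n R k).step_loc_of_ne c hij
    have hr := (midpointAlgorithm n R k).step_reg_of_ne c hij
    simpa only [hist, published, hl, hr] using hc j

theorem hist_prefix_step {c : GlobalState n UnboundedReg MidpointState}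
    (hc : c.WellFormed) (i j : Fin n) :
    c.hist j <+: ((midpointAlgorithm n R k).step c i).hist j := by
  by_cases hij : j = i
  · subst hij
    rcases midpoint_step_cases (R := R) (k := k) hc j with ⟨-, h⟩ | ⟨-, h⟩ | ⟨q, hq, h⟩
    · rw [h]
    · rw [h]; simp [GlobalState.hist, MidpointState.startCollect]
    · rw [h]
      simp only [GlobalState.hist, Function.update_self]
      exact MidpointState.hist_prefix_absorb _ _
  · rw [GlobalState.hist, GlobalState.hist, Algorithm.step_loc_of_ne _ c hij]

/-- A write replaces the register by a history that extends its old contents, so published estimates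
never disappear. -/
theorem published_prefix_step {c : GlobalState n UnboundedReg MidpointState}
    (hc : c.WellFormed) (i j : Fin n) :
    c.published j <+: ((midpointAlgorithm n R k).step c i).published j := by
  by_cases hij : j = i
  · subst hij
    rcases midpoint_step_cases (R := R) (k := k) hc j with ⟨-, h⟩ | ⟨-, h⟩ | ⟨q, hq, h⟩
    · rw [h]
    · rw [h]
      simpa [GlobalState.published] using (hc j).2.2.1
    · rw [h]
  · rw [GlobalState.published, GlobalState.published, Algorithm.step_reg_of_ne _ c hij]

/-- The number of steps that a process has taken, up to a constant. -/
def MidpointState.progress (n : ℕ) (s : MidpointState) : ℕ := s.hist.length * (n + 1) + s.pc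

/-- A round has one write and `n` reads. Its last read resets `pc` from `n` to `0` and lengthens the
history by one, a net gain of `(n + 1) - n`. -/
theorem progress_step {c : GlobalState n UnboundedReg MidpointState}
    (hc : c.WellFormed) (i : Fin n) : R < (c.hist i).length ∨
      (((midpointAlgorithm n R k).step c i).loc i).progress n = (c.loc i).progress n + 1 := by
  rcases midpoint_step_cases (R := R) (k := k) hc i with ⟨h, -⟩ | ⟨h0, h⟩ | ⟨q, hq, h⟩
  · exact Or.inl h
  · right
    rw [h]
    simp [MidpointState.progress, MidpointState.startCollect, h0]
  · right
    rw [h]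
    have := (hc i).2.1
    simp only [Function.update_self, MidpointState.absorb, MidpointState.progress]
    split
    · simp; ring
    · have : (c.loc i).pc = n := by omega
      simp [this]; ring

/-! ### Convergence and correctness of the midpoint algorithm. -/

variable (σ : Fin n → Fin 2) (sched : ℕ → Fin n)

theorem wellFormed_run (m : ℕ) : ((midpointAlgorithm n R k).run σ sched m).WellFormed := by
  induction m with
  | zero =>
    intro i
    simp [Algorithm.run, midpointAlgorithm, GlobalState.hist, GlobalState.published]
  | succ m ih => exact ih.step _

theorem hist_prefix_run {m m' : ℕ} (h : m ≤ m') (i : Fin n) :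
    ((midpointAlgorithm n R k).run σ sched m).hist i <+:
      ((midpointAlgorithm n R k).run σ sched m').hist i := by
  induction m', h using Nat.le_induction with
  | base => exact List.prefix_rfl
  | succ m' _ ih => exact ih.trans (hist_prefix_step (wellFormed_run σ sched m') _ _)

theorem published_prefix_run {m m' : ℕ} (h : m ≤ m') (i : Fin n) :
    ((midpointAlgorithm n R k).run σ sched m).published i <+:
      ((midpointAlgorithm n R k).run σ sched m').published i := by
  induction m', h using Nat.le_induction with
  | base => exact List.prefix_rfl
  | succ m' _ ih => exact ih.trans (published_prefix_step (wellFormed_run σ sched m') _ _)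

theorem getElem?_eq_of_prefix {α : Type} {l l' : List α} (h : l <+: l') {r : ℕ} {x : α}
    (hx : l[r]? = some x) : l'[r]? = some x := by
  obtain ⟨u, rfl⟩ := h
  rw [List.getElem?_append_left (List.getElem?_eq_some_iff.1 hx).1, hx]

/-- The first estimate of a round that is published is seen by all who collect in this round. -/
theorem exists_first_published (i₁ : Fin n) (r : ℕ) {a d : ℚ} (hd : 0 ≤ d)
    (h : ∀ m i x, (((midpointAlgorithm n R k).run σ sched m).hist i)[r]? = some x →
      a ≤ x ∧ x ≤ a + d) :
    ∃ w, a ≤ w ∧ w ≤ a + d ∧ ∃ i₀, ∀ m i,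
      r < (((midpointAlgorithm n R k).run σ sched m).published i).length →
        (((midpointAlgorithm n R k).run σ sched m).published i₀)[r]? = some w := by
  classical
  by_cases hex : ∃ m i, r < (((midpointAlgorithm n R k).run σ sched m).published i).length
  · obtain ⟨i₀, hi₀⟩ := Nat.find_spec hex
    have hw := List.getElem?_eq_getElem hi₀
    refine ⟨_, (h _ i₀ _ (getElem?_eq_of_prefix (wellFormed_run σ sched _ i₀).2.2.1 hw)).1,
      (h _ i₀ _ (getElem?_eq_of_prefix (wellFormed_run σ sched _ i₀).2.2.1 hw)).2, i₀, ?_⟩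
    intro m i hm
    exact getElem?_eq_of_prefix
      (published_prefix_run σ sched (Nat.find_min' hex ⟨i, hm⟩) i₀) hw
  -- If nobody publishes in round `r`, the condition is vacuous and `w`, `i₀` are arbitrary.
  · push Not at hex
    exact ⟨a, le_rfl, by linarith, i₁, fun m i hm => absurd (hex m i) (by omega)⟩

/-- The range of the estimates is halved in each round. -/
theorem exists_halved_range (i₁ : Fin n) (r : ℕ) {a d : ℚ} (hd : 0 ≤ d)
    (h : ∀ m i x, (((midpointAlgorithm n R k).run σ sched m).hist i)[r]? = some x →
      a ≤ x ∧ x ≤ a + d) :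
    ∃ a', a ≤ a' ∧ a' + d / 2 ≤ a + d ∧
      ∀ m i x, (((midpointAlgorithm n R k).run σ sched m).hist i)[r + 1]? = some x →
        a' ≤ x ∧ x ≤ a' + d / 2 := by
  obtain ⟨w, hw1, hw2, i₀, hi₀⟩ := exists_first_published σ sched i₁ r hd h
  -- From `a ≤ lo ≤ w ≤ hi ≤ a + d` the midpoint of `lo` and `hi` lies between `(a + w) / 2` and `(a
  -- + w) / 2 + d / 2`. The invariant `H` says that `w` is enclosed once register `i₀` has been
  -- read.
  refine ⟨(a + w) / 2, by linarith, by linarith, ?_⟩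
  suffices H : ∀ m i,
      (∀ x, (((midpointAlgorithm n R k).run σ sched m).hist i)[r + 1]? = some x →
        (a + w) / 2 ≤ x ∧ x ≤ (a + w) / 2 + d / 2) ∧
      ((((midpointAlgorithm n R k).run σ sched m).hist i).length = r + 1 →
        (((midpointAlgorithm n R k).run σ sched m).loc i).pc ≠ 0 →
        a ≤ (((midpointAlgorithm n R k).run σ sched m).loc i).lo ∧
        (((midpointAlgorithm n R k).run σ sched m).loc i).hi ≤ a + d ∧
        ((i₀ : ℕ) + 1 < (((midpointAlgorithm n R k).run σ sched m).loc i).pc →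
          (((midpointAlgorithm n R k).run σ sched m).loc i).lo ≤ w ∧
          w ≤ (((midpointAlgorithm n R k).run σ sched m).loc i).hi)) from
    fun m i => (H m i).1
  intro m
  induction m with
  | zero =>
    intro i
    simp [Algorithm.run, midpointAlgorithm, GlobalState.hist]
  | succ m ih =>
    intro i
    have hwf := wellFormed_run (R := R) (k := k) σ sched m
    have hm := h m
    have hi₀m := hi₀ m
    rw [Algorithm.run]
    set c := (midpointAlgorithm n R k).run σ sched m with hc
    by_cases hi : i = sched m
    swap
    · simpa only [GlobalState.hist, Algorithm.step_loc_of_ne _ c hi] using ih i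
    subst hi
    obtain ⟨ih1, ih2⟩ := ih (sched m)
    have hne := (hwf (sched m)).1
    rcases midpoint_step_cases (R := R) (k := k) hwf (sched m) with
      ⟨-, h'⟩ | ⟨-, h'⟩ | ⟨q, hq, h'⟩
    · rw [h']; exact ⟨ih1, ih2⟩
    · rw [h']
      simp only [GlobalState.hist, Function.update_self, MidpointState.startCollect]
      refine ⟨ih1, fun hl _ => ?_⟩
      have h1 := hm (sched m) ((c.hist (sched m)).getLastD 0) (by
        rw [List.getLastD_eq_getLast?, List.getLast?_eq_getElem?, GlobalState.hist, hl]
        simp [hl])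
      exact ⟨h1.1, h1.2, fun h => by omega⟩
    · have hpub := (hwf (sched m)).2.2.2 (by omega)
      have hpn := (hwf (sched m)).2.1
      rw [h']
      simp only [GlobalState.hist, Function.update_self] at *
      set s := c.loc (sched m) with hs
      have hnew : s.hist.length = r + 1 →
          a ≤ min s.lo ((c.published q).getD (s.hist.length - 1) s.lo) ∧
          max s.hi ((c.published q).getD (s.hist.length - 1) s.hi) ≤ a + d ∧
          ((i₀ : ℕ) < s.pc →
            min s.lo ((c.published q).getD (s.hist.length - 1) s.lo) ≤ w ∧
            w ≤ max s.hi ((c.published q).getD (s.hist.length - 1) s.hi)) := by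
        intro hl
        obtain ⟨h1, h2, h3⟩ := ih2 hl (by omega)
        -- A collecting process has published its own estimate of the round, so `w` is already in
        -- register `i₀`.
        have h4 := hi₀m (sched m) (by rw [hpub]; omega)
        rw [hl, Nat.add_sub_cancel]
        simp only [List.getD_eq_getElem?_getD]
        refine ⟨?_, ?_, fun h5 => ?_⟩
        · rcases hx : (c.published q)[r]? with _ | x
          · simpa using h1
          · simpa using ⟨h1, (hm q x (getElem?_eq_of_prefix (hwf q).2.2.1 hx)).1⟩
        · rcases hx : (c.published q)[r]? with _ | x
          · simpa using h2
          · simpa using ⟨h2, (hm q x (getElem?_eq_of_prefix (hwf q).2.2.1 hx)).2⟩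
        · by_cases h6 : i₀ = q
          · subst h6
            rw [h4]
            simp
          · have h7 : (i₀ : ℕ) ≠ q := fun e => h6 (Fin.ext e)
            obtain ⟨h8, h9⟩ := h3 (by omega)
            exact ⟨(min_le_left _ _).trans h8, h9.trans (le_max_left _ _)⟩
      simp only [MidpointState.absorb]
      split
      · refine ⟨ih1, fun hl _ => ?_⟩
        obtain ⟨h1, h2, h3⟩ := hnew hl
        exact ⟨h1, h2, fun h4 => h3 (by simp at h4; omega)⟩
      · refine ⟨fun x hx => ?_, fun _ h0 => absurd rfl h0⟩
        simp only [List.getElem?_append] at hx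
        split at hx
        · exact ih1 x hx
        · have hl : s.hist.length = r + 1 := by
            have := (List.getElem?_eq_some_iff.1 hx).1
            simp at this
            omega
          obtain ⟨h1, h2, h3⟩ := hnew hl
          obtain ⟨h4, h5⟩ := h3 (by have := i₀.isLt; omega)
          simp only [hl, Nat.sub_self, List.getElem?_cons_zero, Option.some.injEq] at hx h1 h2 h4 h5
          constructor <;> linarith

/-- The initial width `D` is left free: `D = 1` serves for agreement and `D = 0` for validity. -/
theorem exists_range_of_round (i₁ : Fin n) {A D : ℚ} (hD : 0 ≤ D)
    (hσ : ∀ i, A ≤ ((σ i : ℕ) : ℚ) ∧ ((σ i : ℕ) : ℚ) ≤ A + D) (r : ℕ) :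
    ∃ a, A ≤ a ∧ a + D / 2 ^ r ≤ A + D ∧
      ∀ m i x, (((midpointAlgorithm n R k).run σ sched m).hist i)[r]? = some x →
        a ≤ x ∧ x ≤ a + D / 2 ^ r := by
  induction r with
  | zero =>
    refine ⟨A, le_rfl, by simp, fun m i x hx => ?_⟩
    have h0 : (((midpointAlgorithm n R k).run σ sched 0).hist i)[0]? = some ((σ i : ℕ) : ℚ) := rfl
    have h1 := getElem?_eq_of_prefix (hist_prefix_run σ sched (Nat.zero_le m) i) h0
    rw [hx, Option.some.injEq] at h1
    subst h1
    simpa using hσ i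
  | succ r ih =>
    obtain ⟨a, h1, h2, h3⟩ := ih
    obtain ⟨a', h4, h5, h6⟩ := exists_halved_range σ sched i₁ r (by positivity) h3
    have e : D / 2 ^ (r + 1) = D / 2 ^ r / 2 := by rw [pow_succ]; field_simp
    rw [e]
    exact ⟨a', h1.trans h4, h5.trans h2, h6⟩

theorem midpoint_outConfig_mem (hk : 0 < k) (hR : k ≤ 2 ^ R) (m : ℕ) :
    (midpointAlgorithm n R k).outConfig ((midpointAlgorithm n R k).run σ sched m) ∈
      (approxAgreement n k).Δ σ := by
  have hk' : (0 : ℚ) < k := by exact_mod_cast hk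
  have hout : ∀ i y,
      (midpointAlgorithm n R k).outConfig ((midpointAlgorithm n R k).run σ sched m) i = some y →
      ∃ x, (((midpointAlgorithm n R k).run σ sched m).hist i)[R]? = some x ∧
        y = (⌊(k : ℚ) * x⌋₊ : ℚ) / (k : ℚ) := by
    intro i y hy
    simp only [Algorithm.outConfig] at hy
    simp only [midpointAlgorithm] at hy ⊢
    split at hy
    · next h =>
      refine ⟨_, List.getElem?_eq_getElem h, ?_⟩
      rw [List.getD_eq_getElem _ _ h] at hy
      exact (Option.some.inj hy).symm
    · simp at hy
  have hσ : ∀ i, (0 : ℚ) ≤ ((σ i : ℕ) : ℚ) ∧ ((σ i : ℕ) : ℚ) ≤ 0 + 1 := by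
    intro i
    refine ⟨Nat.cast_nonneg _, ?_⟩
    have : (σ i : ℕ) ≤ 1 := by omega
    rw [zero_add]
    exact_mod_cast this
  obtain ⟨a, ha0, ha1, ha⟩ :=
    exists_range_of_round (R := R) (k := k) σ sched (sched 0) zero_le_one hσ R
  have hpow : (k : ℚ) * (1 / 2 ^ R) ≤ 1 := by
    rw [mul_one_div, div_le_one (by positivity)]
    exact_mod_cast hR
  refine ⟨?_, ?_, ?_⟩
  · intro i y hy
    obtain ⟨x, hx, rfl⟩ := hout i y hy
    refine ⟨_, ?_, rfl⟩
    have h1 := ha m i x hx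
    apply Nat.floor_le_of_le
    nlinarith
  · intro b hb i y hy
    obtain ⟨x, hx, rfl⟩ := hout i y hy
    obtain ⟨a', h0, h1, h2⟩ := exists_range_of_round (R := R) (k := k) σ sched (sched 0)
      (A := ((b : ℕ) : ℚ)) le_rfl (fun i => by simp [hb i]) R
    have h3 := h2 m i x hx
    have h4 : x = ((b : ℕ) : ℚ) := by
      rw [zero_div] at h1 h3
      linarith
    rw [h4, ← Nat.cast_mul, Nat.floor_natCast]
    push_cast
    field_simp
  -- Since `k ≤ 2 ^ R`, the numbers `k * x` spread over at most `1`, so their integer parts differ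
  -- by at most `1`.
  · have key : ∀ x x' : ℚ, a ≤ x → x' ≤ a + 1 / 2 ^ R →
        (⌊(k : ℚ) * x'⌋₊ : ℚ) / k - (⌊(k : ℚ) * x⌋₊ : ℚ) / k ≤ 1 / (k : ℚ) := by
      intro x x' h1 h2
      rw [← sub_div, div_le_div_iff_of_pos_right hk', sub_le_iff_le_add']
      have h3 : (k : ℚ) * x' ≤ k * x + (1 : ℕ) := by push_cast; nlinarith
      have h4 := Nat.floor_le_floor h3
      rw [Nat.floor_add_natCast (by nlinarith)] at h4
      exact_mod_cast h4
    intro i j y z hy hz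
    obtain ⟨x, hx, rfl⟩ := hout i y hy
    obtain ⟨x', hx', rfl⟩ := hout j z hz
    have h1 := ha m i x hx
    have h2 := ha m j x' hx'
    have h3 := key x x' h1.1 h2.2
    have h4 := key x' x h2.1 h1.2
    rw [abs_le]
    constructor <;> linarith

/-- A process that takes infinitely many steps decides. -/
theorem midpoint_exists_decided {i : Fin n} (hi : i ∉ crashed sched) :
    ∃ m, R < (((midpointAlgorithm n R k).run σ sched m).hist i).length := by
  by_contra! hcon
  have hmono : ∀ m, (((midpointAlgorithm n R k).run σ sched m).loc i).progress n ≤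
      (((midpointAlgorithm n R k).run σ sched (m + 1)).loc i).progress n := by
    intro m
    rw [Algorithm.run]
    by_cases him : i = sched m
    · subst him
      rcases progress_step (R := R) (k := k) (wellFormed_run (R := R) (k := k) σ sched m) (sched m) with h | h
      · exact absurd (hcon m) (by omega)
      · omega
    · rw [Algorithm.step_loc_of_ne _ _ him]
  have hunb : ∀ N, ∃ m, N ≤ (((midpointAlgorithm n R k).run σ sched m).loc i).progress n := by
    intro N
    induction N with
    | zero => exact ⟨0, Nat.zero_le _⟩
    | succ N ih =>
      obtain ⟨m, hm⟩ := ih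
      obtain ⟨m', hm', hlt⟩ := Set.Infinite.exists_gt (s := {m | sched m = i}) hi m
      refine ⟨m' + 1, ?_⟩
      have h1 := hm.trans (monotone_nat_of_le_succ hmono hlt.le)
      have hm'' : sched m' = i := hm'
      rw [Algorithm.run, hm'']
      rcases progress_step (R := R) (k := k) (wellFormed_run (R := R) (k := k) σ sched m') i with h | h
      · exact absurd (hcon m') (by omega)
      · omega
  -- Before deciding, the history has at most `R` entries and `pc ≤ n`, so progress is at most `R *
  -- (n + 1) + n`.
  obtain ⟨m, hm⟩ := hunb (R * (n + 1) + n + 1)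
  have h1 := hcon m
  have h2 := (wellFormed_run (R := R) (k := k) σ sched m i).2.1
  have h3 := Nat.mul_le_mul_right (n + 1) h1
  simp only [MidpointState.progress, GlobalState.hist] at *
  omega

end Midpoint

/-! ### Solvability and the theorem. -/

/-- Approximate agreement is solvable with registers of unbounded size. -/
theorem solvableHalting_approxAgreement {n k : ℕ} (t : ℕ) (hk : 0 < k) :
    SolvableHalting UnboundedReg t (approxAgreement n k) := by
  -- `k` rounds suffice since `k ≤ 2 ^ k`.
  refine ⟨MidpointState, midpointAlgorithm n k k, ?_, midpointAlgorithm_haltsOnDecision n k k⟩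
  intro σ _ sched _
  set P := midpointAlgorithm n k k with hP
  -- Each output stabilizes: a crashed process changes nothing after its last step, and any other
  -- decides irrevocably.
  have hlim : ∀ i, ∃ o : Option ℚ, (i ∉ crashed sched → o ≠ none) ∧
      ∀ᶠ m in Filter.atTop, P.outConfig (P.run σ sched m) i = o := by
    intro i
    by_cases hi : i ∈ crashed sched
    · obtain ⟨N, hN⟩ := Set.Finite.bddAbove (s := {m | sched m = i}) hi
      refine ⟨P.outConfig (P.run σ sched (N + 1)) i, fun h => absurd hi h,
        Filter.eventually_atTop.2 ⟨N + 1, fun m hm => ?_⟩⟩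
      · induction m, hm using Nat.le_induction with
        | base => rfl
        | succ m hm ih =>
          rw [← ih]
          simp only [Algorithm.outConfig, Algorithm.run]
          rw [Algorithm.step_loc_of_ne]
          intro h
          have : m ≤ N := hN h.symm
          omega
    · obtain ⟨m₀, hm₀⟩ := midpoint_exists_decided (R := k) (k := k) σ sched hi
      refine ⟨some ((⌊(k : ℚ) * ((P.run σ sched m₀).hist i).getD k 0⌋₊ : ℚ) / (k : ℚ)),
        fun _ => Option.some_ne_none _, Filter.eventually_atTop.2 ⟨m₀, fun m hm => ?_⟩⟩
      · induction m, hm using Nat.le_induction with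
        | base => exact if_pos hm₀
        | succ m hm ih => exact P.output_step _ _ _ _ ih
  choose τ hτ1 hτ2 using hlim
  have hev : ∀ᶠ m in Filter.atTop, P.outConfig (P.run σ sched m) = τ := by
    filter_upwards [Filter.eventually_all.2 hτ2] with m hm
    exact funext hm
  refine ⟨τ, ?_, hτ1, hev⟩
  obtain ⟨m, hm⟩ := hev.exists
  rw [← hm]
  exact midpoint_outConfig_mem σ sched hk Nat.lt_two_pow_self.le m

theorem theorem1 (f : ℕ → ℕ) (n t : ℕ) (hn : 2 < n) (hnt : (n : ℚ) / 2 < (t : ℚ)) (htn : t < n) :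
    ∃ T : DistTask n (Fin 2) ℚ,
      T = approxAgreement n (2 * (2 ^ f n) ^ (n - t + 1) + 1) ∧
      SolvableHalting UnboundedReg t T ∧
      ¬ Solvable (BitReg (f n)) t T := by
  refine ⟨_, rfl, solvableHalting_approxAgreement t (Nat.succ_pos _), ?_⟩
  have h : n < 2 * t := by
    rw [div_lt_iff₀ two_pos] at hnt
    have : n < t * 2 := by exact_mod_cast hnt
    omega
  have := not_solvable_approxAgreement (BitReg (f n)) h htn
  simpa [BitReg] using this
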